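/- Let $\mathbf N=\{1,2,3,\dots\}$. Let $\mathcal H$ be a complex Hilbert space carrying a representation of the Cuntz algebra $\mathcal O_2$, i.e. operators $t_1,t_2$ with $t_i^*t_j=\delta_{ij}I$ and $t_1t_1^*+t_2t_2^*=I$, with a cyclic unit vector $\Omega$ such that $t_1\Omega=\Omega$. Let $\mathcal D$ be the (dense) linear span of the vectors $t_{i_1}\cdots t_{i_k}\Omega$ ($k\ge1$), and put $s_m=t_2^{m-1}t_1$ ($m\ge1$). On $\mathcal D$ define the recursive boson system by $$b_1=\sum_{m\ge1}\sqrt m\,s_ms_{m+1}^*,\qquad b_n=\rho(b_{n-1})\ (n\ge2),\qquad \rho(x)=\sum_{m\ge1}s_mxs_m^*,$$ together with the conjugates $b_1^*=\sum_{m\ge1}\sqrt m\,s_{m+1}s_m^*$, $b_n^*=\rho(b_{n-1}^*)$ (on each vector of $\mathcal D$ all these sums are finite). On $\mathcal H$ define the recursive fermion system by $$a_1=t_1t_2^*,\qquad a_n=\zeta(a_{n-1})\ (n\ge2),\qquad \zeta(y)=t_1yt_1^*-t_2yt_2^*.$$ Let $\mathcal H_B$ be a Fock representation of the bosons $\{b_n\}_{n\in\mathbf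 N}$: operators $b_n,b_n^*$ on a dense subspace $\mathcal D_B$, formally adjoint to each other and satisfying $b_nb_m^*-b_m^*b_n=\delta_{nm}I$, $b_nb_m-b_mb_n=b_n^*b_m^*-b_m^*b_n^*=0$, with a unit vacuum vector $\Omega_B\in\mathcal D_B$ such that $b_n\Omega_B=0$ for all $n$ and the algebra generated by all $b_n,b_n^*$ maps $\Omega_B$ onto $\mathcal D_B$. Let $\mathcal H_F$ be a Fock representation of the fermions $\{a_n\}_{n\in\mathbf N}$: bounded operators with $a_na_m^*+a_m^*a_n=\delta_{nm}I$, $a_na_m+a_ma_n=a_n^*a_m^*+a_m^*a_n^*=0$, with a unit vacuum vector $\Omega_F$, cyclic for the $*$-algebra they generate, such that $a_n\Omega_F=0$ for all $n$. Then there is a unique unitary $V_B:\mathcal H\to\mathcal H_B$ with $V_B\mathcal D=\mathcal D_B$ and $V_B\Omega=\Omega_B$ that carries the recursive boson system ($b_n$ and $b_n^*$ on $\mathcal D$) to the operators $b_n,b_n^*$ of $\mathcal H_B$, and a unique unitary $V_F:\mathcal H\to\mathcal H_F$ with $V_F\Omega=\Omega_F$ that carries the recursive fermion system to the operators $a_n$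 of $\mathcal H_F$. Put $U=V_FV_B^*:\mathcal H_B\to\mathcal H_F$. The adjoint $U^*$ satisfies $$U^*\Omega_F=\Omega_B .$$ Moreover, let $S$ be a nonempty finite subset of $\mathbf N$ with block decomposition $S=S_1\sqcup\cdots\sqcup S_m$, where $S_i=\{n_i,n_i+1,\dots,n_i+l_i\}$, $l_i\ge0$, and $n_i+l_i+1<n_{i+1}$ for $1\le i<m$; and let $a_S^*=a_{p_1}^*\cdots a_{p_k}^*$ where $S=\{p_1<\cdots<p_k\}$. Then $$U^*a_S^*\Omega_F=\{(l_1+1)!\cdots(l_m+1)!\}^{-1/2}\,(b_{n_1}^*)^{l_1+1}(b_{n_2-(l_1+1)}^*)^{l_2+1}\cdots\bigl(b_{n_m-\sum_{i=1}^{m-1}(l_i+1)}^*\bigr)^{l_m+1}\Omega_B .$$ -/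

import Mathlib

open ContinuousLinearMap (adjoint)
open scoped InnerProductSpace Nat

/-!
Conventions. Modes and generators, usually numbered `1, 2, 3, …`, are numbered from `0` here, so `t 0, t 1` are the canonical generators usually written `t₁, t₂`, and
`s m`, `b n`, `a n` here are `s_{m+1}`, `b_{n+1}`, `a_{n+1}` in one-based numbering.
-/

/-- A representation of the Cuntz algebra `𝒪₂` on a Hilbert space `H` (given, by universality of
`𝒪₂`, by the images `t 0, t 1` of its canonical generators), together with a cyclic unit
vector `Ω` fixed by the first generator. -/
structure CuntzRep (H : Type*) [NormedAddCommGroup H] [InnerProductSpace ℂ H]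
    [CompleteSpace H] where
  t : Fin 2 → H →L[ℂ] H
  orthonormal_rel : ∀ i j, adjoint (t i) * t j = if i = j then 1 else 0
  sum_rel : t 0 * adjoint (t 0) + t 1 * adjoint (t 1) = 1
  Ω : H
  norm_Ω : ‖Ω‖ = 1
  cyclic : Dense {x : H | ∃ A ∈ StarAlgebra.adjoin ℂ (Set.range t), A Ω = x}
  fixed : t 0 Ω = Ω

/-- A Fock representation of the canonical commutation relations: a representation of the
`*`-algebra of bosons by endomorphisms of a dense subspace `D`, where `b n` and `bdag n`
are the images of `bₙ` and `bₙ*`, with a cyclic unit vector `vac ∈ D` (the algebra generated by all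
`b n`, `bdag n` maps `vac` onto the whole of `D`) annihilated by every `b n`. -/
structure BoseFock (H : Type*) [NormedAddCommGroup H] [InnerProductSpace ℂ H]
    [CompleteSpace H] where
  D : Submodule ℂ H
  dense_D : Dense (D : Set H)
  b : ℕ → Module.End ℂ D
  bdag : ℕ → Module.End ℂ D
  isAdjoint : ∀ n (x y : D), ⟪(b n x : H), (y : H)⟫_ℂ = ⟪(x : H), (bdag n y : H)⟫_ℂ
  ccr : ∀ n m, b n * bdag m - bdag m * b n = if n = m then 1 else 0
  ccr_b : ∀ n m, b n * b m - b m * b n = 0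
  ccr_bdag : ∀ n m, bdag n * bdag m - bdag m * bdag n = 0
  vac : D
  norm_vac : ‖vac‖ = 1
  cyclic : ∀ x : D, ∃ A ∈ Algebra.adjoin ℂ (Set.range b ∪ Set.range bdag), A vac = x
  annihilate : ∀ n, b n vac = 0

/-- A Fock representation of the canonical anticommutation relations: bounded operators `a n` on
`H` with the anticommutation relations, and a unit vector `vac` annihilated by every `a n`
and cyclic for the `*`-algebra generated by them. -/
structure FermiFock (H : Type*) [NormedAddCommGroup H] [InnerProductSpace ℂ H]
    [CompleteSpace H] where
  a : ℕ → H →L[ℂ] H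
  car : ∀ n m, a n * adjoint (a m) + adjoint (a m) * a n = if n = m then 1 else 0
  car_a : ∀ n m, a n * a m + a m * a n = 0
  car_adag : ∀ n m, adjoint (a n) * adjoint (a m) + adjoint (a m) * adjoint (a n) = 0
  vac : H
  norm_vac : ‖vac‖ = 1
  cyclic : Dense {x : H | ∃ A ∈ StarAlgebra.adjoin ℂ (Set.range a), A vac = x}
  annihilate : ∀ n, a n vac = 0

/-- The pointwise finite sum `∑ₘ f m` of endomorphisms, all but finitely many of which vanish on
any given vector. -/
noncomputable def locallyFiniteSum {D : Type*} [AddCommGroup D] [Module ℂ D]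
    (f : ℕ → Module.End ℂ D) (hf : ∀ v, (Function.support fun m => f m v).Finite) :
    Module.End ℂ D where
  toFun v := ∑ᶠ m, f m v
  map_add' v w := by
    simp only [map_add]
    exact finsum_add_distrib (hf v) (hf w)
  map_smul' c v := by
    simp only [map_smul, RingHom.id_apply]
    exact (smul_finsum' c (hf v)).symm

namespace CuntzRep

variable {H : Type*} [NormedAddCommGroup H] [InnerProductSpace ℂ H] [CompleteSpace H]
  (C : CuntzRep H)

/-- The vector `t_{i₁} ⋯ t_{iₖ} Ω` of a word `i₁ … iₖ`. -/
def word (w : List (Fin 2)) : H := (w.map C.t).prod C.Ω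

/-- The linear span of the vectors `t_{i₁} ⋯ t_{iₖ} Ω`, `k ≥ 1`. -/
def D : Submodule ℂ H := Submodule.span ℂ {x | ∃ w : List (Fin 2), w ≠ [] ∧ C.word w = x}

theorem word_nil : C.word [] = C.Ω := by simp [word]

theorem word_cons (i : Fin 2) (w : List (Fin 2)) : C.word (i :: w) = C.t i (C.word w) := by
  simp [word]

theorem word_mem (w : List (Fin 2)) : C.word w ∈ C.D := by
  refine Submodule.subset_span ?_
  rcases eq_or_ne w [] with rfl | hw
  · exact ⟨[0], by simp, by rw [word_cons, word_nil, C.fixed]⟩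
  · exact ⟨w, hw, rfl⟩

theorem Ω_mem : C.Ω ∈ C.D := C.word_nil ▸ C.word_mem []

theorem adjoint_t_apply (i j : Fin 2) (x : H) :
    adjoint (C.t i) (C.t j x) = if i = j then x else 0 := by
  have h := congrArg (fun A : H →L[ℂ] H => A x) (C.orthonormal_rel i j)
  simp only [mul_apply_eq_comp] at h
  rw [h]
  split_ifs <;> simp

theorem t_mem (i : Fin 2) {x : H} (hx : x ∈ C.D) : C.t i x ∈ C.D := by
  refine Submodule.span_induction ?_ ?_ ?_ ?_ hx
  · rintro _ ⟨w, -, rfl⟩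
    rw [← word_cons]
    exact C.word_mem _
  · simp
  · intro x y _ _ h1 h2
    rw [map_add]
    exact add_mem h1 h2
  · intro c x _ h
    rw [map_smul]
    exact C.D.smul_mem c h

theorem adjoint_t_mem (i : Fin 2) {x : H} (hx : x ∈ C.D) : adjoint (C.t i) x ∈ C.D := by
  refine Submodule.span_induction ?_ ?_ ?_ ?_ hx
  · rintro _ ⟨w, hw, rfl⟩
    obtain ⟨j, w, rfl⟩ := List.exists_cons_of_ne_nil hw
    rw [word_cons, adjoint_t_apply]
    split_ifs
    · exact C.word_mem _
    · simp
  · simp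
  · intro x y _ _ h1 h2
    rw [map_add]
    exact add_mem h1 h2
  · intro c x _ h
    rw [map_smul]
    exact C.D.smul_mem c h

/-- The isometries `s m = (t 1)^m (t 0)` generating `𝒪_∞` inside `𝒪₂`. -/
noncomputable def s (m : ℕ) : H →L[ℂ] H := C.t 1 ^ m * C.t 0

theorem s_zero_apply (x : H) : C.s 0 x = C.t 0 x := by simp [s]

theorem s_succ (m : ℕ) : C.s (m + 1) = C.t 1 * C.s m := by simp [s, pow_succ', mul_assoc]

theorem adjoint_s_succ_apply (m : ℕ) (x : H) :
    adjoint (C.s (m + 1)) x = adjoint (C.s m) (adjoint (C.t 1) x) := by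
  rw [s_succ, ← ContinuousLinearMap.star_eq_adjoint, star_mul]
  rfl

theorem s_mem (m : ℕ) : ∀ x ∈ C.D, (C.s m : H →ₗ[ℂ] H) x ∈ C.D := by
  induction m with
  | zero =>
    intro x hx
    simpa [s] using C.t_mem 0 hx
  | succ m ih =>
    intro x hx
    simpa [s_succ] using C.t_mem 1 (ih x hx)

theorem adjoint_s_mem (m : ℕ) : ∀ x ∈ C.D, (adjoint (C.s m) : H →ₗ[ℂ] H) x ∈ C.D := by
  induction m with
  | zero =>
    intro x hx
    simpa [s] using C.adjoint_t_mem 0 hx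
  | succ m ih =>
    intro x hx
    have h := ih _ (C.adjoint_t_mem 1 hx)
    simp only [ContinuousLinearMap.coe_coe] at h ⊢
    rwa [adjoint_s_succ_apply]

theorem adjoint_s_word (w : List (Fin 2)) :
    ∀ m, w.length < m → adjoint (C.s m) (C.word w) = 0 := by
  induction w with
  | nil =>
    intro m hm
    obtain ⟨m, rfl⟩ := Nat.exists_eq_succ_of_ne_zero (Nat.ne_of_gt hm)
    have h : adjoint (C.t 1) C.Ω = 0 := by
      have h := C.adjoint_t_apply 1 0 C.Ω
      rw [C.fixed] at h
      simpa using h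
    rw [Nat.succ_eq_add_one, adjoint_s_succ_apply, word_nil, h, map_zero]
  | cons i w ih =>
    intro m hm
    obtain ⟨m, rfl⟩ := Nat.exists_eq_succ_of_ne_zero (Nat.ne_of_gt (Nat.zero_lt_of_lt hm))
    rw [Nat.succ_eq_add_one, adjoint_s_succ_apply, word_cons, adjoint_t_apply]
    split_ifs
    · exact ih m (by simpa using hm)
    · simp

theorem adjoint_s_eventually {x : H} (hx : x ∈ C.D) :
    ∃ N, ∀ m, N < m → adjoint (C.s m) x = 0 := by
  refine Submodule.span_induction ?_ ?_ ?_ ?_ hx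
  · rintro _ ⟨w, -, rfl⟩
    exact ⟨w.length, C.adjoint_s_word w⟩
  · exact ⟨0, by simp⟩
  · rintro x y _ _ ⟨N, h1⟩ ⟨M, h2⟩
    refine ⟨max N M, fun m hm => ?_⟩
    rw [map_add, h1 m (lt_of_le_of_lt (le_max_left _ _) hm),
      h2 m (lt_of_le_of_lt (le_max_right _ _) hm), add_zero]
  · rintro c x _ ⟨N, h⟩
    exact ⟨N, fun m hm => by rw [map_smul, h m hm, smul_zero]⟩

/-- `s m` restricted to `D`. -/
noncomputable def sD (m : ℕ) : Module.End ℂ C.D := (C.s m : H →ₗ[ℂ] H).restrict (C.s_mem m)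

/-- `(s m)*` restricted to `D`. -/
noncomputable def sDadj (m : ℕ) : Module.End ℂ C.D :=
  (adjoint (C.s m) : H →ₗ[ℂ] H).restrict (C.adjoint_s_mem m)

theorem sDadj_eventually (v : C.D) : ∃ N, ∀ m, N < m → C.sDadj m v = 0 := by
  obtain ⟨N, h⟩ := C.adjoint_s_eventually v.2
  exact ⟨N, fun m hm => Subtype.ext (h m hm)⟩

theorem support_finite (g : ℕ → Module.End ℂ C.D) (k : ℕ) (v : C.D) :
    (Function.support fun m => (g m * C.sDadj (m + k)) v).Finite := by
  obtain ⟨N, h⟩ := C.sDadj_eventually v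
  refine (Set.finite_Iic N).subset fun m hm => ?_
  by_contra hlt
  simp only [Set.mem_Iic, not_le] at hlt
  exact hm (by simp [h (m + k) (by omega)])

/-- `ρ(x) = ∑ₘ s m · x · (s m)*` on `D`. -/
noncomputable def rho (x : Module.End ℂ C.D) : Module.End ℂ C.D :=
  locallyFiniteSum (fun m => C.sD m * x * C.sDadj m)
    (fun v => C.support_finite (fun m => C.sD m * x) 0 v)

/-- The recursive boson system on `D`: the first annihilation operator is
`∑ₘ √(m+1) · s m · (s (m+1))*`, and each further one is `ρ` of the preceding one. -/
noncomputable def rbs : ℕ → Module.End ℂ C.D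
  | 0 => locallyFiniteSum
      (fun m => ((Real.sqrt (m + 1) : ℝ) : ℂ) • C.sD m * C.sDadj (m + 1))
      (fun v => C.support_finite (fun m => ((Real.sqrt (m + 1) : ℝ) : ℂ) • C.sD m) 1 v)
  | n + 1 => C.rho (rbs n)

/-- The conjugates of the recursive boson system on `D`: the first creation operator is
`∑ₘ √(m+1) · s (m+1) · (s m)*`, and each further one is `ρ` of the preceding one. -/
noncomputable def rbsDag : ℕ → Module.End ℂ C.D
  | 0 => locallyFiniteSum
      (fun m => ((Real.sqrt (m + 1) : ℝ) : ℂ) • C.sD (m + 1) * C.sDadj m)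
      (fun v => C.support_finite (fun m => ((Real.sqrt (m + 1) : ℝ) : ℂ) • C.sD (m + 1)) 0 v)
  | n + 1 => C.rho (rbsDag n)

/-- The recursive fermion system: the first operator is `(t 0)(t 1)*`, and each further one is
`ζ` of the preceding one, with `ζ(y) = (t 0) y (t 0)* - (t 1) y (t 1)*`. -/
noncomputable def rfs : ℕ → H →L[ℂ] H
  | 0 => C.t 0 * adjoint (C.t 1)
  | n + 1 => C.t 0 * rfs n * adjoint (C.t 0) - C.t 1 * rfs n * adjoint (C.t 1)

end CuntzRep

/-- `V` is a unitary equivalence between the recursive boson system on `C.D` and the Bose-Fock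
representation `B` that carries `Ω` to the vacuum: `V D = D_B`, `V Ω = Ω_B` and
`V π_RBS(·) V* = π_B` on generators. -/
structure IsBoseEquiv {H HB : Type*} [NormedAddCommGroup H] [InnerProductSpace ℂ H]
    [CompleteSpace H] [NormedAddCommGroup HB] [InnerProductSpace ℂ HB] [CompleteSpace HB]
    (C : CuntzRep H) (B : BoseFock HB) (V : H ≃ₗᵢ[ℂ] HB) : Prop where
  map_D : ∀ x : H, V x ∈ B.D ↔ x ∈ C.D
  map_Ω : V C.Ω = B.vac
  map_b : ∀ n (x : C.D) (y : B.D), V x = y → V (C.rbs n x) = B.b n y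
  map_bdag : ∀ n (x : C.D) (y : B.D), V x = y → V (C.rbsDag n x) = B.bdag n y

/-- `V` is a unitary equivalence between the recursive fermion system and the Fermi-Fock
representation `F` that carries `Ω` to the vacuum: `V Ω = Ω_F` and
`V π_RFS(·) V* = π_F` on generators. -/
structure IsFermiEquiv {H HF : Type*} [NormedAddCommGroup H] [InnerProductSpace ℂ H]
    [CompleteSpace H] [NormedAddCommGroup HF] [InnerProductSpace ℂ HF] [CompleteSpace HF]
    (C : CuntzRep H) (F : FermiFock HF) (V : H ≃ₗᵢ[ℂ] HF) : Prop where
  map_Ω : V C.Ω = F.vac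
  map_a : ∀ n (x : H), V (C.rfs n x) = F.a n (V x)

/-- The operator `U = V_F V_B*` from the Bose-Fock space to the Fermi-Fock space. -/
noncomputable def boseFermiU {H HB HF : Type*} [NormedAddCommGroup H] [InnerProductSpace ℂ H]
    [CompleteSpace H] [NormedAddCommGroup HB] [InnerProductSpace ℂ HB] [CompleteSpace HB]
    [NormedAddCommGroup HF] [InnerProductSpace ℂ HF] [CompleteSpace HF]
    (VB : H ≃ₗᵢ[ℂ] HB) (VF : H ≃ₗᵢ[ℂ] HF) : HB →L[ℂ] HF :=
  (VF : H →L[ℂ] HF) ∘L adjoint (VB : H →L[ℂ] HB)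

/-- `S = S₁ ⊔ ⋯ ⊔ Sₘ` is the block decomposition of `S`: the blocks are
`Sᵢ = {nᵢ, nᵢ + 1, …, nᵢ + lᵢ}`, and `nᵢ + lᵢ + 1 < nᵢ₊₁` (so that the blocks are disjoint). -/
def IsBlockDecomposition (S : Finset ℕ) {m : ℕ} (n l : Fin m → ℕ) : Prop :=
  S = Finset.univ.biUnion (fun i => Finset.Icc (n i) (n i + l i)) ∧
    ∀ i j : Fin m, (i : ℕ) + 1 = j → n i + l i + 1 < n j

/-- `a_S* = a_{n₁}* ⋯ a_{nₖ}*` for `S = {n₁ < ⋯ < nₖ}`. -/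
noncomputable def FermiFock.creation {H : Type*} [NormedAddCommGroup H] [InnerProductSpace ℂ H]
    [CompleteSpace H] (F : FermiFock H) (S : Finset ℕ) : H →L[ℂ] H :=
  ((S.sort (· ≤ ·)).map fun n => adjoint (F.a n)).prod

/-! Everything is compared inside the Cuntz space `H`, where both systems are Fock with the same
vacuum `Ω`. With modes numbered from 0, each higher mode is defined by a recursion that commutes
with `t 0` up to an index shift: `b_{n+1}* t₀ = t₀ b_n*` and `a_{n+1}* t₀ = t₀ a_n*`, with `t₀ Ω =
Ω`.

The lowest modes read powers of `t₁` in two ways. On the boson side `(b₀*)^k t₀ z = √(k!) t₁^k t₀ z`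
(`rbsDag_zero_pow_sD_zero`). On the fermion side `t₁ = a₀* t₀` on `H`, so `t₁^k` puts `a₀* ⋯
a_{k-1}*` in front of a product of creation operators and raises its indices by `k`
(`t_one_pow_fockVec_rfsDag`). Hence a run of `k` consecutive fermions is a normalised `k`-fold
boson, and the later fermion indices drop by `k`. `fockVec_range'_append` proves this for one block,
and induction over the blocks gives the formula.

The unitaries exist because the (anti)commutation relations and the vacuum condition determine all
inner products of vectors built by creation operators (`inner_fockMap_eq`). These vectors exhaust
the boson domains and span dense subspaces on the fermion side, so matching them defines an isometry
and also forces uniqueness. -/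

/-! ### Fock modules: inner products determined by the relations. -/

/-- The generators `c n`, their conjugates `cdag n` and a vacuum vector of a Fock module: bosonic for
`ε = 1`, fermionic for `ε = -1`. -/
structure IsFockModule {E : Type*} [NormedAddCommGroup E] [InnerProductSpace ℂ E]
    (ε : ℂ) (c cdag : ℕ → Module.End ℂ E) (vac : E) : Prop where
  isAdjoint : ∀ n x y, ⟪c n x, y⟫_ℂ = ⟪x, cdag n y⟫_ℂ
  comm : ∀ n m x, c n (cdag m x) = ε • cdag m (c n x) + if n = m then x else 0
  norm_vac : ‖vac‖ = 1
  annihilate : ∀ n, c n vac = 0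

/-- The vector obtained from the vacuum by a product of creation operators. -/
def fockVec {E : Type*} [AddCommGroup E] [Module ℂ E] (cdag : ℕ → Module.End ℂ E) (vac : E)
    (l : List ℕ) : E := (l.map cdag).prod vac

/-- The linear map sending formal combinations of products of creation operators to vectors. -/
noncomputable def fockMap {E : Type*} [AddCommGroup E] [Module ℂ E] (cdag : ℕ → Module.End ℂ E)
    (vac : E) : (List ℕ →₀ ℂ) →ₗ[ℂ] E := Finsupp.linearCombination ℂ (fockVec cdag vac)

/-- The action of a creation operator on formal combinations. -/
noncomputable def formalCreation (n : ℕ) : (List ℕ →₀ ℂ) →ₗ[ℂ] (List ℕ →₀ ℂ) :=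
  Finsupp.lmapDomain ℂ ℂ (List.cons n)

/-- The action of an annihilation operator on a product of creation operators. -/
noncomputable def formalAnnihilationAux (ε : ℂ) (n : ℕ) : List ℕ → (List ℕ →₀ ℂ)
  | [] => 0
  | m :: l => ε • formalCreation m (formalAnnihilationAux ε n l) +
      if n = m then Finsupp.single l 1 else 0

/-- The action of an annihilation operator on formal combinations. -/
noncomputable def formalAnnihilation (ε : ℂ) (n : ℕ) : (List ℕ →₀ ℂ) →ₗ[ℂ] (List ℕ →₀ ℂ) :=
  Finsupp.linearCombination ℂ (formalAnnihilationAux ε n)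

section FockVec

variable {E : Type*} [AddCommGroup E] [Module ℂ E] (cdag : ℕ → Module.End ℂ E) (vac : E)

theorem fockVec_nil : fockVec cdag vac [] = vac := by simp [fockVec]

theorem fockVec_cons (n : ℕ) (l : List ℕ) :
    fockVec cdag vac (n :: l) = cdag n (fockVec cdag vac l) := by simp [fockVec]

theorem fockMap_single (l : List ℕ) : fockMap cdag vac (Finsupp.single l 1) = fockVec cdag vac l := by
  simp [fockMap]

theorem fockMap_formalCreation (n : ℕ) (f : List ℕ →₀ ℂ) :
    fockMap cdag vac (formalCreation n f) = cdag n (fockMap cdag vac f) := by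
  have : fockMap cdag vac ∘ₗ formalCreation n = cdag n ∘ₗ fockMap cdag vac := by
    ext l
    simp [formalCreation, fockMap, fockVec_cons]
  exact LinearMap.congr_fun this f

theorem range_fockMap :
    LinearMap.range (fockMap cdag vac) = Submodule.span ℂ (Set.range (fockVec cdag vac)) :=
  Finsupp.range_linearCombination ℂ

end FockVec

namespace IsFockModule

variable {E : Type*} [NormedAddCommGroup E] [InnerProductSpace ℂ E] {ε : ℂ}
  {c cdag : ℕ → Module.End ℂ E} {vac : E}
  {E' : Type*} [NormedAddCommGroup E'] [InnerProductSpace ℂ E']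
  {c' cdag' : ℕ → Module.End ℂ E'} {vac' : E'}

/-- Commuting `c n` to the right until it meets the vacuum is a computation on formal combinations
that does not depend on the module. Two Fock modules can therefore be compared through the same
formal element. -/
theorem fockMap_formalAnnihilation (h : IsFockModule ε c cdag vac) (n : ℕ) (f : List ℕ →₀ ℂ) :
    fockMap cdag vac (formalAnnihilation ε n f) = c n (fockMap cdag vac f) := by
  have key : ∀ l, fockMap cdag vac (formalAnnihilationAux ε n l) = c n (fockVec cdag vac l) := by
    intro l
    induction l with
    | nil => simp [formalAnnihilationAux, fockVec_nil, h.annihilate]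
    | cons m l ih =>
      rw [formalAnnihilationAux, map_add, map_smul, fockMap_formalCreation, ih, fockVec_cons, h.comm]
      split_ifs
      · rw [fockMap_single]
      · rw [map_zero]
  have : fockMap cdag vac ∘ₗ formalAnnihilation ε n = c n ∘ₗ fockMap cdag vac := by
    ext l
    simpa [formalAnnihilation, fockMap_single] using key l
  exact LinearMap.congr_fun this f

theorem inner_vac_fockMap_eq (h : IsFockModule ε c cdag vac) (h' : IsFockModule ε c' cdag' vac')
    (f : List ℕ →₀ ℂ) : ⟪vac, fockMap cdag vac f⟫_ℂ = ⟪vac', fockMap cdag' vac' f⟫_ℂ := by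
  induction f using Finsupp.induction_linear with
  | zero => simp
  | add f g hf hg => rw [map_add, map_add, inner_add_right, inner_add_right, hf, hg]
  | single l z =>
    rw [← mul_one z, ← smul_eq_mul, ← Finsupp.smul_single, map_smul, map_smul, fockMap_single,
      fockMap_single, inner_smul_right, inner_smul_right]
    congr 1
    cases l with
    | nil =>
      rw [fockVec_nil, fockVec_nil, inner_self_eq_norm_sq_to_K, inner_self_eq_norm_sq_to_K,
        h.norm_vac, h'.norm_vac]
    | cons m l =>
      rw [fockVec_cons, fockVec_cons, ← h.isAdjoint, ← h'.isAdjoint, h.annihilate, h'.annihilate,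
        inner_zero_left, inner_zero_left]

theorem inner_fockMap_eq (h : IsFockModule ε c cdag vac) (h' : IsFockModule ε c' cdag' vac')
    (f g : List ℕ →₀ ℂ) : ⟪fockMap cdag vac f, fockMap cdag vac g⟫_ℂ =
      ⟪fockMap cdag' vac' f, fockMap cdag' vac' g⟫_ℂ := by
  -- Each creation operator on the right moves to the left as an annihilation operator and is
  -- absorbed into the formal combination. The left argument `g` thus changes at every step and must
  -- be quantified.
  have key : ∀ l g, ⟪fockMap cdag vac g, fockVec cdag vac l⟫_ℂ =
      ⟪fockMap cdag' vac' g, fockVec cdag' vac' l⟫_ℂ := by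
    intro l
    induction l with
    | nil =>
      intro g
      rw [fockVec_nil, fockVec_nil, ← inner_conj_symm, h.inner_vac_fockMap_eq h', inner_conj_symm]
    | cons m l ih =>
      intro g
      rw [fockVec_cons, fockVec_cons, ← h.isAdjoint, ← h'.isAdjoint, ← h.fockMap_formalAnnihilation,
        ← h'.fockMap_formalAnnihilation, ih]
  induction g using Finsupp.induction_linear with
  | zero => simp
  | add g₁ g₂ h₁ h₂ => rw [map_add, map_add, inner_add_right, inner_add_right, h₁, h₂]
  | single l z =>
    rw [← mul_one z, ← smul_eq_mul, ← Finsupp.smul_single, map_smul, map_smul, fockMap_single,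
      fockMap_single, inner_smul_right, inner_smul_right, key]

theorem norm_fockMap_eq (h : IsFockModule ε c cdag vac) (h' : IsFockModule ε c' cdag' vac')
    (f : List ℕ →₀ ℂ) : ‖fockMap cdag vac f‖ = ‖fockMap cdag' vac' f‖ := by
  rw [@norm_eq_sqrt_re_inner ℂ, @norm_eq_sqrt_re_inner ℂ, h.inner_fockMap_eq h']

/-- Shows that a vacuum cyclic for the whole algebra is already cyclic for the creation operators.
-/
theorem map_mem_range_fockMap (h : IsFockModule ε c cdag vac)
    {A : Module.End ℂ E} (hA : A ∈ Algebra.adjoin ℂ (Set.range c ∪ Set.range cdag)) :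
    ∀ x ∈ LinearMap.range (fockMap cdag vac), A x ∈ LinearMap.range (fockMap cdag vac) := by
  induction hA using Algebra.adjoin_induction with
  | mem A hA =>
    rintro _ ⟨f, rfl⟩
    rcases hA with ⟨n, rfl⟩ | ⟨n, rfl⟩
    · exact ⟨_, h.fockMap_formalAnnihilation n f⟩
    · exact ⟨_, fockMap_formalCreation cdag vac n f⟩
  | algebraMap r =>
    intro x hx
    rw [Module.algebraMap_end_apply]
    exact Submodule.smul_mem _ _ hx
  | add A B _ _ hA hB => exact fun x hx => add_mem (hA x hx) (hB x hx)
  | mul A B _ _ hA hB => exact fun x hx => hA _ (hB x hx)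

end IsFockModule

theorem vac_mem_range_fockMap {E : Type*} [AddCommGroup E] [Module ℂ E]
    (cdag : ℕ → Module.End ℂ E) (vac : E) : vac ∈ LinearMap.range (fockMap cdag vac) :=
  ⟨Finsupp.single [] 1, by rw [fockMap_single, fockVec_nil]⟩

/-! ### Unitaries determined on dense ranges, and invariant subspaces. -/

/-- Linear maps with dense ranges that give every vector the same norm differ by a unitary. -/
theorem exists_linearIsometryEquiv_of_norm_eq {M H K : Type*} [AddCommGroup M] [Module ℂ M]
    [NormedAddCommGroup H] [InnerProductSpace ℂ H] [CompleteSpace H]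
    [NormedAddCommGroup K] [InnerProductSpace ℂ K] [CompleteSpace K]
    (f : M →ₗ[ℂ] H) (g : M →ₗ[ℂ] K) (hf : DenseRange f) (hg : DenseRange g)
    (hfg : ∀ x, ‖f x‖ = ‖g x‖) : ∃ V : H ≃ₗᵢ[ℂ] K, ∀ x, V (f x) = g x := by
  have h₁ : ∀ x, ‖g (LinearEquiv.refl ℂ M x)‖ = ‖f x‖ := fun x => (hfg x).symm
  refine ⟨(LinearEquiv.refl ℂ M).extendOfIsometry f g hf hg h₁, fun x => ?_⟩
  exact LinearEquiv.extendOfIsometry_eq _ _ _ hf hg h₁ x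

theorem linearIsometryEquiv_ext_of_dense {M H K : Type*} [AddCommGroup M] [Module ℂ M]
    [NormedAddCommGroup H] [InnerProductSpace ℂ H] [NormedAddCommGroup K] [InnerProductSpace ℂ K]
    {f : M →ₗ[ℂ] H} (hf : DenseRange f) {V W : H ≃ₗᵢ[ℂ] K} (h : ∀ x, V (f x) = W (f x)) :
    V = W :=
  DFunLike.coe_injective (hf.equalizer V.continuous W.continuous (funext h))

theorem locallyFiniteSum_apply {D : Type*} [AddCommGroup D] [Module ℂ D]
    (f : ℕ → Module.End ℂ D) (hf) (v : D) : locallyFiniteSum f hf v = ∑ᶠ m, f m v := rfl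

theorem mapsTo_of_mem_starAlgebra_adjoin {H : Type*} [NormedAddCommGroup H]
    [InnerProductSpace ℂ H] [CompleteSpace H] {W : Submodule ℂ H} {s : Set (H →L[ℂ] H)}
    (hs : ∀ A ∈ s, ∀ x ∈ W, A x ∈ W) (hs' : ∀ A ∈ s, ∀ x ∈ W, adjoint A x ∈ W)
    {A : H →L[ℂ] H} (hA : A ∈ StarAlgebra.adjoin ℂ s) : ∀ x ∈ W, A x ∈ W := by
  suffices h : (∀ x ∈ W, A x ∈ W) ∧ ∀ x ∈ W, star A x ∈ W from h.1
  induction hA using StarAlgebra.adjoin_induction with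
  | mem A hA => exact ⟨hs A hA, hs' A hA⟩
  | algebraMap r =>
    constructor
    · intro x hx
      rw [Algebra.algebraMap_eq_smul_one]
      exact W.smul_mem r hx
    · intro x hx
      rw [Algebra.algebraMap_eq_smul_one, star_smul, star_one]
      exact W.smul_mem _ hx
  | add A B _ _ hA hB =>
    refine ⟨fun x hx => add_mem (hA.1 x hx) (hB.1 x hx), fun x hx => ?_⟩
    rw [star_add]
    exact add_mem (hA.2 x hx) (hB.2 x hx)
  | mul A B _ _ hA hB =>
    refine ⟨fun x hx => hA.1 _ (hB.1 x hx), fun x hx => ?_⟩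
    rw [star_mul]
    exact hB.2 _ (hA.2 x hx)
  | star A _ hA => exact ⟨hA.2, by rw [star_star]; exact hA.1⟩

/-! ### The recursive boson system as a Fock module on `D`. -/

namespace CuntzRep

variable {H : Type*} [NormedAddCommGroup H] [InnerProductSpace ℂ H] [CompleteSpace H]
  (C : CuntzRep H)

theorem s_succ_apply (m : ℕ) (x : H) : C.s (m + 1) x = C.t 1 (C.s m x) := by
  rw [s_succ]; rfl

theorem s_apply (m : ℕ) (x : H) : C.s m x = (C.t 1 ^ m) (C.t 0 x) := rfl

theorem adjoint_s_apply (i j : ℕ) (x : H) :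
    adjoint (C.s i) (C.s j x) = if i = j then x else 0 := by
  induction i generalizing j with
  | zero =>
    have h0 : C.s 0 = C.t 0 := by ext x; exact C.s_zero_apply x
    cases j with
    | zero => rw [h0, C.adjoint_t_apply]; rfl
    | succ j => rw [s_succ_apply, h0, C.adjoint_t_apply]; simp
  | succ i ih =>
    rw [adjoint_s_succ_apply]
    cases j with
    | zero => rw [s_zero_apply, C.adjoint_t_apply]; simp
    | succ j => rw [s_succ_apply, C.adjoint_t_apply, if_pos rfl, ih]; simp

theorem coe_sD (m : ℕ) (x : C.D) : (C.sD m x : H) = C.s m x := rfl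

theorem sDadj_sD (i j : ℕ) (x : C.D) : C.sDadj i (C.sD j x) = if i = j then x else 0 := by
  apply Subtype.ext
  change adjoint (C.s i) (C.s j x) = _
  rw [adjoint_s_apply]
  split_ifs <;> rfl

theorem inner_sD_sD (i j : ℕ) (x y : C.D) :
    ⟪C.sD i x, C.sD j y⟫_ℂ = if i = j then ⟪x, y⟫_ℂ else 0 := by
  rw [Submodule.coe_inner, coe_sD, coe_sD, ← ContinuousLinearMap.adjoint_inner_right,
    adjoint_s_apply]
  split_ifs <;> simp

/-- The index `m` counts the letters 1 before the first 0. If there is no 0, the equality `Ω = t₀ Ω`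
supplies one. -/
theorem exists_s_eq_word (w : List (Fin 2)) : ∃ m, ∃ y : C.D, C.s m y = C.word w := by
  induction w with
  | nil => exact ⟨0, ⟨_, C.Ω_mem⟩, by rw [s_zero_apply, C.fixed, word_nil]⟩
  | cons i w ih =>
    fin_cases i
    · exact ⟨0, ⟨_, C.word_mem w⟩, by rw [s_zero_apply, word_cons]; rfl⟩
    · obtain ⟨m, y, h⟩ := ih
      exact ⟨m + 1, y, by rw [s_succ_apply, h, word_cons]; rfl⟩

/-- Reduces every identity on `D` to vectors `sD m y`: mode 0 changes only `m`, while higher modes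
act only on `y`. -/
theorem induction_on_D {p : C.D → Prop} (hs : ∀ m y, p (C.sD m y))
    (hadd : ∀ x y, p x → p y → p (x + y)) (hsmul : ∀ (r : ℂ) x, p x → p (r • x)) (x : C.D) : p x := by
  obtain ⟨x, hx⟩ := x
  refine Submodule.span_induction (p := fun x hx => p ⟨x, hx⟩) ?_ ?_ ?_ ?_ hx
  · rintro _ ⟨w, -, rfl⟩
    obtain ⟨m, y, h⟩ := C.exists_s_eq_word w
    have := hs m y
    rwa [show C.sD m y = ⟨C.word w, C.word_mem w⟩ from Subtype.ext h] at this
  · have := hsmul 0 _ (hs 0 0)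
    rwa [zero_smul] at this
  · exact fun x y hx hy h₁ h₂ => hadd ⟨x, hx⟩ ⟨y, hy⟩ h₁ h₂
  · exact fun r x hx h => hsmul r ⟨x, hx⟩ h

theorem rho_sD (x : Module.End ℂ C.D) (m : ℕ) (y : C.D) :
    C.rho x (C.sD m y) = C.sD m (x y) := by
  rw [rho, locallyFiniteSum_apply, finsum_eq_single _ m]
  · simp [sDadj_sD]
  · intro k hk
    simp [sDadj_sD, hk]

theorem rbs_zero_sD_zero (y : C.D) : C.rbs 0 (C.sD 0 y) = 0 := by
  rw [rbs, locallyFiniteSum_apply]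
  simp [sDadj_sD]

theorem rbs_zero_sD_succ (m : ℕ) (y : C.D) :
    C.rbs 0 (C.sD (m + 1) y) = ((Real.sqrt (m + 1) : ℝ) : ℂ) • C.sD m y := by
  rw [rbs, locallyFiniteSum_apply, finsum_eq_single _ m]
  · simp [sDadj_sD]
  · intro k hk
    simp [sDadj_sD, hk]

theorem rbs_succ_sD (n m : ℕ) (y : C.D) : C.rbs (n + 1) (C.sD m y) = C.sD m (C.rbs n y) :=
  C.rho_sD _ m y

theorem rbsDag_zero_sD (m : ℕ) (y : C.D) :
    C.rbsDag 0 (C.sD m y) = ((Real.sqrt (m + 1) : ℝ) : ℂ) • C.sD (m + 1) y := by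
  rw [rbsDag, locallyFiniteSum_apply, finsum_eq_single _ m]
  · simp [sDadj_sD]
  · intro k hk
    simp [sDadj_sD, hk]

theorem rbsDag_succ_sD (n m : ℕ) (y : C.D) :
    C.rbsDag (n + 1) (C.sD m y) = C.sD m (C.rbsDag n y) :=
  C.rho_sD _ m y

theorem inner_rbs (n : ℕ) (x y : C.D) : ⟪C.rbs n x, y⟫_ℂ = ⟪x, C.rbsDag n y⟫_ℂ := by
  induction n generalizing x y with
  | zero =>
    induction x using C.induction_on_D with
    | hadd a b ha hb => rw [map_add, inner_add_left, inner_add_left, ha, hb]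
    | hsmul r a ha => rw [map_smul, inner_smul_left, inner_smul_left, ha]
    | hs m x =>
      induction y using C.induction_on_D with
      | hadd a b ha hb => rw [map_add, inner_add_right, inner_add_right, ha, hb]
      | hsmul r a ha => rw [map_smul, inner_smul_right, inner_smul_right, ha]
      | hs k y =>
        rw [rbsDag_zero_sD, inner_smul_right, inner_sD_sD]
        cases m with
        | zero => simp [rbs_zero_sD_zero]
        | succ m =>
          rw [rbs_zero_sD_succ, inner_smul_left, inner_sD_sD, Complex.conj_ofReal]
          by_cases h : m = k
          · simp [h]
          · simp [h]
  | succ n ih =>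
    induction x using C.induction_on_D with
    | hadd a b ha hb => rw [map_add, inner_add_left, inner_add_left, ha, hb]
    | hsmul r a ha => rw [map_smul, inner_smul_left, inner_smul_left, ha]
    | hs m x =>
      induction y using C.induction_on_D with
      | hadd a b ha hb => rw [map_add, inner_add_right, inner_add_right, ha, hb]
      | hsmul r a ha => rw [map_smul, inner_smul_right, inner_smul_right, ha]
      | hs k y => rw [rbs_succ_sD, rbsDag_succ_sD, inner_sD_sD, inner_sD_sD, ih]

theorem ofReal_sqrt_mul_self (m : ℕ) :
    ((Real.sqrt (m + 1) : ℝ) : ℂ) * ((Real.sqrt (m + 1) : ℝ) : ℂ) = m + 1 := by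
  rw [← Complex.ofReal_mul, Real.mul_self_sqrt (by positivity)]
  push_cast
  rfl

/-- For `n = m = 0` the weights give `(k + 1) - k = 1` on the range of `sD k`. Mode 0 commutes with
a higher mode because one moves the index of `sD` and the other acts behind it. Two higher modes
reduce to the preceding pair. -/
theorem rbs_rbsDag (n m : ℕ) (x : C.D) :
    C.rbs n (C.rbsDag m x) = C.rbsDag m (C.rbs n x) + if n = m then x else 0 := by
  induction n generalizing m x with
  | zero =>
    induction x using C.induction_on_D with
    | hadd a b ha hb =>
      simp only [map_add, ha, hb]
      split_ifs <;> abel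
    | hsmul r a ha =>
      simp only [map_smul, ha, smul_add]
      split_ifs <;> simp
    | hs k x =>
      cases m with
      | zero =>
        rw [rbsDag_zero_sD, map_smul, rbs_zero_sD_succ, smul_smul, ofReal_sqrt_mul_self, if_pos rfl]
        cases k with
        | zero => simp [rbs_zero_sD_zero]
        | succ k =>
          rw [rbs_zero_sD_succ, map_smul, rbsDag_zero_sD, smul_smul, ofReal_sqrt_mul_self]
          push_cast
          module
      | succ m =>
        rw [rbsDag_succ_sD]
        cases k with
        | zero => simp [rbs_zero_sD_zero]
        | succ k => simp [rbs_zero_sD_succ, rbsDag_succ_sD]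
  | succ n ih =>
    induction x using C.induction_on_D with
    | hadd a b ha hb =>
      simp only [map_add, ha, hb]
      split_ifs <;> abel
    | hsmul r a ha =>
      simp only [map_smul, ha, smul_add]
      split_ifs <;> simp
    | hs k x =>
      cases m with
      | zero => simp [rbs_succ_sD, rbsDag_zero_sD]
      | succ m =>
        rw [rbsDag_succ_sD, rbs_succ_sD, ih, rbs_succ_sD, rbsDag_succ_sD, map_add]
        simp only [add_left_inj, add_right_inj]
        split_ifs <;> simp

/-- The vector `Ω` as an element of the domain `D`. -/
def ΩD : C.D := ⟨C.Ω, C.Ω_mem⟩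

theorem sD_zero_ΩD : C.sD 0 C.ΩD = C.ΩD :=
  Subtype.ext (by rw [coe_sD, s_zero_apply]; exact C.fixed)

theorem rbs_ΩD (n : ℕ) : C.rbs n C.ΩD = 0 := by
  induction n with
  | zero => rw [← sD_zero_ΩD, rbs_zero_sD_zero]
  | succ n ih => rw [← sD_zero_ΩD, rbs_succ_sD, ih, map_zero]

theorem isFockModule_rbs : IsFockModule 1 C.rbs C.rbsDag C.ΩD where
  isAdjoint := C.inner_rbs
  comm n m x := by rw [rbs_rbsDag, one_smul]
  norm_vac := C.norm_Ω
  annihilate := C.rbs_ΩD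

/-- The weights `√1, √2, …, √k` multiply to `√(k!)`; this is the source of the factorials in the
final formula. -/
theorem rbsDag_zero_pow_sD_zero (k : ℕ) (y : C.D) :
    (C.rbsDag 0 ^ k) (C.sD 0 y) = ((Real.sqrt (k ! : ℕ) : ℝ) : ℂ) • C.sD k y := by
  induction k with
  | zero => simp
  | succ k ih =>
    rw [pow_succ', Module.End.mul_apply, ih, map_smul, rbsDag_zero_sD, smul_smul,
      ← Complex.ofReal_mul, ← Real.sqrt_mul (by positivity), Nat.factorial_succ]
    push_cast
    rw [mul_comm]

/-- `sD 0` raises every creation index by one, so it preserves the span; `sD m` is then reached from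
`sD 0` by `m` creations in mode 0, up to a nonzero scalar. -/
theorem sD_mem_range_fockMap (m : ℕ) {x : C.D} (hx : x ∈ LinearMap.range (fockMap C.rbsDag C.ΩD)) :
    C.sD m x ∈ LinearMap.range (fockMap C.rbsDag C.ΩD) := by
  have hpow : C.rbsDag 0 ^ m ∈ Algebra.adjoin ℂ (Set.range C.rbs ∪ Set.range C.rbsDag) :=
    pow_mem (Algebra.subset_adjoin (Set.mem_union_right _ (Set.mem_range_self 0))) m
  have h0 : C.sD 0 x ∈ LinearMap.range (fockMap C.rbsDag C.ΩD) := by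
    rw [range_fockMap] at hx ⊢
    induction hx using Submodule.span_induction with
    | mem x hx =>
      obtain ⟨l, rfl⟩ := hx
      refine Submodule.subset_span ⟨l.map (· + 1), ?_⟩
      induction l with
      | nil => rw [List.map_nil, fockVec_nil, sD_zero_ΩD]
      | cons n l ih => rw [List.map_cons, fockVec_cons, ih, fockVec_cons, rbsDag_succ_sD]
    | zero => simp
    | add x y _ _ hx hy => rw [map_add]; exact add_mem hx hy
    | smul r x _ hx => rw [map_smul]; exact Submodule.smul_mem _ _ hx
  have h := C.isFockModule_rbs.map_mem_range_fockMap hpow _ h0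
  rw [rbsDag_zero_pow_sD_zero] at h
  refine (Submodule.smul_mem_iff _ ?_).1 h
  rw [Complex.ofReal_ne_zero]
  positivity

theorem range_fockMap_rbsDag : LinearMap.range (fockMap C.rbsDag C.ΩD) = ⊤ := by
  -- The exponent `m` stores the letters 1 already read until a 0, or the final `Ω = t₀ Ω`,
  -- completes an `sD m`.
  have key : ∀ (w : List (Fin 2)) (m : ℕ), ∃ y ∈ LinearMap.range (fockMap C.rbsDag C.ΩD),
      (y : H) = (C.t 1 ^ m) (C.word w) := by
    intro w
    induction w with
    | nil =>
      intro m
      refine ⟨C.sD m C.ΩD, C.sD_mem_range_fockMap m (vac_mem_range_fockMap _ _), ?_⟩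
      rw [coe_sD, s_apply, ΩD, C.fixed, word_nil]
    | cons i w ih =>
      intro m
      fin_cases i
      · obtain ⟨y, hy, h⟩ := ih 0
        refine ⟨C.sD m y, C.sD_mem_range_fockMap m hy, ?_⟩
        rw [coe_sD, s_apply, h, word_cons]
        rfl
      · obtain ⟨y, hy, h⟩ := ih (m + 1)
        refine ⟨y, hy, ?_⟩
        rw [h, word_cons, pow_succ]
        rfl
  rw [eq_top_iff]
  rintro ⟨x, hx⟩ -
  induction hx using Submodule.span_induction with
  | mem x hx =>
    obtain ⟨w, -, rfl⟩ := hx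
    obtain ⟨y, hy, h⟩ := key w 0
    rwa [show y = ⟨C.word w, C.word_mem w⟩ from Subtype.ext h] at hy
  | zero => exact zero_mem _
  | add x y hx hy h₁ h₂ => exact add_mem h₁ h₂
  | smul r x hx h => exact Submodule.smul_mem _ r h

theorem dense_D : Dense (C.D : Set H) := by
  refine C.cyclic.mono ?_
  rintro _ ⟨A, hA, rfl⟩
  refine mapsTo_of_mem_starAlgebra_adjoin ?_ ?_ hA _ C.Ω_mem
  · rintro _ ⟨i, rfl⟩ x hx
    exact C.t_mem i hx
  · rintro _ ⟨i, rfl⟩ x hx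
    exact C.adjoint_t_mem i hx

/-! ### The recursive fermion system and its anticommutation relations. -/

theorem rfs_zero_apply (x : H) : C.rfs 0 x = C.t 0 (adjoint (C.t 1) x) := rfl

theorem rfs_succ_apply (n : ℕ) (x : H) : C.rfs (n + 1) x =
    C.t 0 (C.rfs n (adjoint (C.t 0) x)) - C.t 1 (C.rfs n (adjoint (C.t 1) x)) := rfl

theorem adjoint_rfs_zero_apply (x : H) :
    adjoint (C.rfs 0) x = C.t 1 (adjoint (C.t 0) x) := by
  rw [rfs, ← ContinuousLinearMap.star_eq_adjoint, star_mul, ← ContinuousLinearMap.star_eq_adjoint,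
    star_star]
  rfl

theorem adjoint_rfs_succ_apply (n : ℕ) (x : H) : adjoint (C.rfs (n + 1)) x =
    C.t 0 (adjoint (C.rfs n) (adjoint (C.t 0) x)) -
      C.t 1 (adjoint (C.rfs n) (adjoint (C.t 1) x)) := by
  rw [rfs]
  simp only [← ContinuousLinearMap.star_eq_adjoint, star_sub, star_mul, star_star]
  rfl

theorem decomposition (x : H) : C.t 0 (adjoint (C.t 0) x) + C.t 1 (adjoint (C.t 1) x) = x :=
  congrArg (fun A : H →L[ℂ] H => A x) C.sum_rel

theorem ext_of_t {A B : H →L[ℂ] H} (h : ∀ i x, A (C.t i x) = B (C.t i x)) : A = B := by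
  ext x
  rw [← C.decomposition x, map_add, map_add, h, h]

theorem rfs_zero_t_zero (x : H) : C.rfs 0 (C.t 0 x) = 0 := by
  simp [rfs_zero_apply, adjoint_t_apply]

theorem rfs_zero_t_one (x : H) : C.rfs 0 (C.t 1 x) = C.t 0 x := by
  simp [rfs_zero_apply, adjoint_t_apply]

theorem rfs_succ_t_zero (n : ℕ) (x : H) : C.rfs (n + 1) (C.t 0 x) = C.t 0 (C.rfs n x) := by
  simp [rfs_succ_apply, adjoint_t_apply]

theorem rfs_succ_t_one (n : ℕ) (x : H) : C.rfs (n + 1) (C.t 1 x) = -C.t 1 (C.rfs n x) := by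
  simp [rfs_succ_apply, adjoint_t_apply]

theorem adjoint_rfs_zero_t_zero (x : H) : adjoint (C.rfs 0) (C.t 0 x) = C.t 1 x := by
  simp [adjoint_rfs_zero_apply, adjoint_t_apply]

theorem adjoint_rfs_zero_t_one (x : H) : adjoint (C.rfs 0) (C.t 1 x) = 0 := by
  simp [adjoint_rfs_zero_apply, adjoint_t_apply]

theorem adjoint_rfs_succ_t_zero (n : ℕ) (x : H) :
    adjoint (C.rfs (n + 1)) (C.t 0 x) = C.t 0 (adjoint (C.rfs n) x) := by
  simp [adjoint_rfs_succ_apply, adjoint_t_apply]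

theorem adjoint_rfs_succ_t_one (n : ℕ) (x : H) :
    adjoint (C.rfs (n + 1)) (C.t 1 x) = -C.t 1 (adjoint (C.rfs n) x) := by
  simp [adjoint_rfs_succ_apply, adjoint_t_apply]

/-- Checked on the ranges of `t₀` and `t₁`. The minus sign in `ζ` makes mode 0 anticommute with the
higher modes; for two higher modes it occurs twice and cancels. -/
theorem rfs_car (n m : ℕ) :
    C.rfs n * adjoint (C.rfs m) + adjoint (C.rfs m) * C.rfs n = if n = m then 1 else 0 := by
  induction n generalizing m with
  | zero =>
    refine C.ext_of_t fun i x => ?_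
    fin_cases i <;> cases m <;>
      simp [rfs_zero_t_zero, rfs_zero_t_one, adjoint_rfs_zero_t_zero, adjoint_rfs_zero_t_one,
        adjoint_rfs_succ_t_zero, adjoint_rfs_succ_t_one]
  | succ n ih =>
    refine C.ext_of_t fun i x => ?_
    cases m with
    | zero =>
      fin_cases i <;>
      simp [rfs_succ_t_zero, rfs_succ_t_one, adjoint_rfs_zero_t_zero, adjoint_rfs_zero_t_one]
    | succ m =>
      have h := congrArg (fun A : H →L[ℂ] H => C.t i (A x)) (ih m)
      simp only [add_left_inj]
      refine Eq.trans ?_ (h.trans ?_)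
      · fin_cases i <;> simp [rfs_succ_t_zero, rfs_succ_t_one, adjoint_rfs_succ_t_zero,
          adjoint_rfs_succ_t_one]
      · split_ifs <;> simp

theorem rfs_Ω (n : ℕ) : C.rfs n C.Ω = 0 := by
  induction n with
  | zero => rw [← C.fixed, rfs_zero_t_zero]
  | succ n ih => rw [← C.fixed, rfs_succ_t_zero, ih, map_zero]

end CuntzRep

/-! ### The given Fock representations as Fock modules. -/

theorem isFockModule_of_car {H : Type*} [NormedAddCommGroup H] [InnerProductSpace ℂ H]
    [CompleteSpace H] {a : ℕ → H →L[ℂ] H} {vac : H}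
    (car : ∀ n m, a n * adjoint (a m) + adjoint (a m) * a n = if n = m then 1 else 0)
    (norm_vac : ‖vac‖ = 1) (annihilate : ∀ n, a n vac = 0) :
    IsFockModule (-1) (fun n => (a n : H →ₗ[ℂ] H)) (fun n => (adjoint (a n) : H →ₗ[ℂ] H)) vac where
  isAdjoint n x y := (ContinuousLinearMap.adjoint_inner_right (a n) x y).symm
  comm n m x := by
    have h := congrArg (fun A : H →L[ℂ] H => A x) (car n m)
    have h' : a n (adjoint (a m) x) + adjoint (a m) (a n x) = if n = m then x else 0 :=
      h.trans (by split_ifs <;> rfl)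
    simp only [ContinuousLinearMap.coe_coe, ← h']
    module
  norm_vac := norm_vac
  annihilate := annihilate

theorem BoseFock.isFockModule {H : Type*} [NormedAddCommGroup H] [InnerProductSpace ℂ H]
    [CompleteSpace H] (B : BoseFock H) : IsFockModule 1 B.b B.bdag B.vac where
  isAdjoint := B.isAdjoint
  comm n m x := by
    have h := congrArg (fun A : Module.End ℂ B.D => A x) (B.ccr n m)
    have h' : B.b n (B.bdag m x) - B.bdag m (B.b n x) = if n = m then x else 0 :=
      h.trans (by split_ifs <;> rfl)
    rw [← h', one_smul, add_sub_cancel]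
  norm_vac := B.norm_vac
  annihilate := B.annihilate

theorem BoseFock.range_fockMap {H : Type*} [NormedAddCommGroup H] [InnerProductSpace ℂ H]
    [CompleteSpace H] (B : BoseFock H) : LinearMap.range (fockMap B.bdag B.vac) = ⊤ := by
  rw [eq_top_iff]
  rintro x -
  obtain ⟨A, hA, rfl⟩ := B.cyclic x
  exact B.isFockModule.map_mem_range_fockMap hA _ (vac_mem_range_fockMap _ _)

theorem FermiFock.isFockModule {H : Type*} [NormedAddCommGroup H] [InnerProductSpace ℂ H]
    [CompleteSpace H] (F : FermiFock H) :
    IsFockModule (-1) (fun n => (F.a n : H →ₗ[ℂ] H)) (fun n => (adjoint (F.a n) : H →ₗ[ℂ] H))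
      F.vac :=
  isFockModule_of_car F.car F.norm_vac F.annihilate

theorem FermiFock.denseRange_fockMap {H : Type*} [NormedAddCommGroup H] [InnerProductSpace ℂ H]
    [CompleteSpace H] (F : FermiFock H) :
    DenseRange (fockMap (fun n => (adjoint (F.a n) : H →ₗ[ℂ] H)) F.vac) := by
  refine F.cyclic.mono ?_
  rintro _ ⟨A, hA, rfl⟩
  refine mapsTo_of_mem_starAlgebra_adjoin (W := LinearMap.range (fockMap _ _)) ?_ ?_ hA _
    (vac_mem_range_fockMap _ _)
  · rintro _ ⟨n, rfl⟩ _ ⟨f, rfl⟩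
    exact ⟨_, F.isFockModule.fockMap_formalAnnihilation n f⟩
  · rintro _ ⟨n, rfl⟩ _ ⟨f, rfl⟩
    exact ⟨_, fockMap_formalCreation _ _ n f⟩

/-! ### Fermionic vectors inside `H` and their bosonic form. -/

namespace CuntzRep

variable {H : Type*} [NormedAddCommGroup H] [InnerProductSpace ℂ H] [CompleteSpace H]
  (C : CuntzRep H)

/-- The creation operators of the recursive fermion system, as linear maps. -/
noncomputable def rfsDag (n : ℕ) : Module.End ℂ H := (adjoint (C.rfs n) : H →ₗ[ℂ] H)

theorem isFockModule_rfs :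
    IsFockModule (-1) (fun n => (C.rfs n : H →ₗ[ℂ] H)) C.rfsDag C.Ω :=
  isFockModule_of_car C.rfs_car C.norm_Ω C.rfs_Ω

theorem rfsDag_zero_t_zero (x : H) : C.rfsDag 0 (C.t 0 x) = C.t 1 x := C.adjoint_rfs_zero_t_zero x

theorem rfsDag_succ_t_zero (n : ℕ) (x : H) :
    C.rfsDag (n + 1) (C.t 0 x) = C.t 0 (C.rfsDag n x) := C.adjoint_rfs_succ_t_zero n x

theorem t_zero_fockVec_rfsDag (l : List ℕ) :
    C.t 0 (fockVec C.rfsDag C.Ω l) = fockVec C.rfsDag C.Ω (l.map (· + 1)) := by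
  induction l with
  | nil => rw [List.map_nil, fockVec_nil, C.fixed]
  | cons n l ih => rw [List.map_cons, fockVec_cons, fockVec_cons, ← ih, rfsDag_succ_t_zero]

/-- Since `t₁ = a₀* t₀`, each factor `t₁` raises all indices by one and then fills the vacated mode
0. -/
theorem t_one_pow_fockVec_rfsDag (k : ℕ) (l : List ℕ) :
    (C.t 1 ^ k) (fockVec C.rfsDag C.Ω l) =
      fockVec C.rfsDag C.Ω (List.range' 0 k ++ l.map (· + k)) := by
  induction k with
  | zero => simp
  | succ k ih =>
    rw [pow_succ']
    change C.t 1 ((C.t 1 ^ k) _) = _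
    rw [ih, ← rfsDag_zero_t_zero, t_zero_fockVec_rfsDag, ← fockVec_cons]
    congr 1
    rw [List.range'_succ, List.range'_succ_left, List.map_append, List.map_map, List.cons_append]
    rfl

theorem dense_range_fockMap_rfsDag : DenseRange (fockMap C.rfsDag C.Ω) := by
  have h0 : ∀ x ∈ LinearMap.range (fockMap C.rfsDag C.Ω),
      C.t 0 x ∈ LinearMap.range (fockMap C.rfsDag C.Ω) := by
    intro x hx
    rw [range_fockMap] at hx ⊢
    induction hx using Submodule.span_induction with
    | mem x hx =>
      obtain ⟨l, rfl⟩ := hx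
      exact Submodule.subset_span ⟨l.map (· + 1), (C.t_zero_fockVec_rfsDag l).symm⟩
    | zero => simp
    | add x y _ _ hx hy => rw [map_add]; exact add_mem hx hy
    | smul r x _ hx => rw [map_smul]; exact Submodule.smul_mem _ _ hx
  have hword : ∀ w, C.word w ∈ LinearMap.range (fockMap C.rfsDag C.Ω) := by
    intro w
    induction w with
    | nil => rw [word_nil]; exact vac_mem_range_fockMap _ _
    | cons i w ih =>
      rw [word_cons]
      fin_cases i
      · exact h0 _ ih
      · obtain ⟨f, hf⟩ := h0 _ ih
        refine ⟨formalCreation 0 f, ?_⟩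
        rw [fockMap_formalCreation, hf, rfsDag_zero_t_zero]
        rfl
  refine C.dense_D.mono ?_
  change C.D ≤ LinearMap.range (fockMap C.rfsDag C.Ω)
  refine Submodule.span_le.2 ?_
  rintro _ ⟨w, -, rfl⟩
  exact hword w

theorem rfsDag_mem (n : ℕ) {x : H} (hx : x ∈ C.D) : C.rfsDag n x ∈ C.D := by
  induction n generalizing x with
  | zero =>
    change adjoint (C.rfs 0) x ∈ C.D
    rw [adjoint_rfs_zero_apply]
    exact C.t_mem 1 (C.adjoint_t_mem 0 hx)
  | succ n ih =>
    change adjoint (C.rfs (n + 1)) x ∈ C.D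
    rw [adjoint_rfs_succ_apply]
    exact sub_mem (C.t_mem 0 (ih (C.adjoint_t_mem 0 hx))) (C.t_mem 1 (ih (C.adjoint_t_mem 1 hx)))

theorem fockVec_rfsDag_mem (l : List ℕ) : fockVec C.rfsDag C.Ω l ∈ C.D := by
  induction l with
  | nil => rw [fockVec_nil]; exact C.Ω_mem
  | cons n l ih => rw [fockVec_cons]; exact C.rfsDag_mem n ih

theorem rbsDag_succ_pow_sD (n k m : ℕ) (y : C.D) :
    (C.rbsDag (n + 1) ^ k) (C.sD m y) = C.sD m ((C.rbsDag n ^ k) y) := by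
  induction k with
  | zero => simp
  | succ k ih => rw [pow_succ', pow_succ', Module.End.mul_apply, Module.End.mul_apply, ih,
      rbsDag_succ_sD]

theorem coe_sD_zero (y : C.D) : (C.sD 0 y : H) = C.t 0 y := by rw [coe_sD, s_zero_apply]

theorem map_add_one_map_pred {l : List ℕ} {n : ℕ} (hl : ∀ x ∈ l, n < x) :
    (l.map Nat.pred).map (· + 1) = l := by
  rw [List.map_map]
  conv_rhs => rw [← List.map_id l]
  refine List.map_congr_left fun x hx => ?_
  have := hl x hx
  simp only [Function.comp_apply, Nat.pred_eq_sub_one, id]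
  omega

/-- The core of the correspondence. As all indices in `l` are positive, `y = t₀ z`. For `n = 0`,
both sides are `t₁^k t₀ z`. For larger `n`, a factor `t₀` comes out of both sides and lowers every
index by one. -/
theorem fockVec_range'_append (n k : ℕ) (l : List ℕ) (hl : ∀ x ∈ l, n < x) (y : C.D)
    (hy : fockVec C.rfsDag C.Ω l = y) :
    fockVec C.rfsDag C.Ω (List.range' n k ++ l.map (· + k)) =
      (((Real.sqrt (k ! : ℕ))⁻¹ : ℝ) : ℂ) • ((C.rbsDag n ^ k) y : H) := by
  induction n generalizing l y with
  | zero =>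
    have hl' := map_add_one_map_pred hl
    -- The word with all indices lowered by one; `Nat.pred` does not truncate here because the
    -- entries are positive.
    set z : C.D := ⟨_, C.fockVec_rfsDag_mem (l.map Nat.pred)⟩ with hz
    have hyz : y = C.sD 0 z :=
      Subtype.ext (by rw [coe_sD_zero, hz, t_zero_fockVec_rfsDag, hl', hy])
    rw [← t_one_pow_fockVec_rfsDag, hy, hyz, rbsDag_zero_pow_sD_zero, Submodule.coe_smul, smul_smul,
      ← Complex.ofReal_mul, inv_mul_cancel₀ (by positivity), Complex.ofReal_one, one_smul,
      coe_sD_zero]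
    rfl
  | succ n ih =>
    have hl' := map_add_one_map_pred hl
    set z : C.D := ⟨_, C.fockVec_rfsDag_mem (l.map Nat.pred)⟩ with hz
    have hyz : y = C.sD 0 z :=
      Subtype.ext (by rw [coe_sD_zero, hz, t_zero_fockVec_rfsDag, hl', hy])
    have h := congrArg (C.t 0) (ih (l.map Nat.pred) (by
      intro x hx
      obtain ⟨x, hx', rfl⟩ := List.mem_map.1 hx
      have := hl x hx'
      rw [Nat.pred_eq_sub_one]
      omega) z rfl)
    rw [t_zero_fockVec_rfsDag, map_smul, ← coe_sD_zero, ← rbsDag_succ_pow_sD, ← hyz] at h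
    rw [← h, List.map_append, ← List.range'_succ_left, List.map_map]
    conv_lhs => rw [← hl', List.map_map]
    congr 3
    funext x
    simp only [Function.comp_apply]
    omega

theorem sum_Iio_succ {m : ℕ} (f : Fin (m + 1) → ℕ) (i : Fin m) :
    ∑ j ∈ Finset.Iio i.succ, f j = f 0 + ∑ j ∈ Finset.Iio i, f j.succ := by
  have h : ∀ {k : ℕ} (i : Fin k), Finset.Iio i = Finset.univ.filter (· < i) := fun i => by
    ext; simp
  rw [h, h, Finset.sum_filter, Finset.sum_filter, Fin.sum_univ_succ]
  simp

/-- Induction on the number of blocks: removing the first lowers all later indices by its length `l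
0 + 1`, and these shifts accumulate into the sum over the preceding blocks. -/
theorem fockVec_flatten_blocks {m : ℕ} (n l : Fin m → ℕ)
    (h : ∀ i j, i < j → n i + l i + 1 < n j) :
    fockVec C.rfsDag C.Ω (List.ofFn fun i => List.range' (n i) (l i + 1)).flatten =
      (((Real.sqrt (∏ i, (l i + 1)! : ℕ))⁻¹ : ℝ) : ℂ) •
        (((List.ofFn fun i : Fin m =>
          C.rbsDag (n i - ∑ j ∈ Finset.Iio i, (l j + 1)) ^ (l i + 1)).prod C.ΩD : C.D) : H) := by
  induction m with
  | zero => simp [fockVec_nil, ΩD]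
  | succ m ih =>
    have h0 : ∀ i : Fin m, n 0 + l 0 + 1 < n i.succ := fun i => h 0 i.succ (Fin.succ_pos i)
    -- The gap condition makes `n i.succ - (l 0 + 1)` larger than `n 0`. The subtraction is
    -- therefore exact, and the remaining indices satisfy the hypothesis of `fockVec_range'_append`.
    have ih' := ih (fun i => n i.succ - (l 0 + 1)) (fun i => l i.succ) (by
      intro i j hij
      have h1 := h i.succ j.succ (Fin.succ_lt_succ_iff.2 hij)
      have h2 := h0 i
      have h3 := h0 j
      omega)
    rw [← Submodule.coe_smul] at ih'
    have hshift : (List.ofFn fun i : Fin m => List.range' (n i.succ) (l i.succ + 1)).flatten =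
        (List.ofFn fun i : Fin m =>
          List.range' (n i.succ - (l 0 + 1)) (l i.succ + 1)).flatten.map (· + (l 0 + 1)) := by
      rw [List.map_flatten, List.map_ofFn]
      congr 2
      funext i
      have h2 := h0 i
      simp only [Function.comp_apply]
      rw [show (fun x => x + (l 0 + 1)) = fun x => (l 0 + 1) + x from funext fun x => add_comm _ _,
        List.map_add_range']
      congr 1
      omega
    rw [List.ofFn_succ, List.flatten_cons, hshift, C.fockVec_range'_append _ _ _ _ _ ih',
      map_smul, Submodule.coe_smul, smul_smul, ← Complex.ofReal_mul, List.ofFn_succ, List.prod_cons,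
      Module.End.mul_apply, Fin.prod_univ_succ, ← mul_inv, Nat.cast_mul,
      Real.sqrt_mul (Nat.cast_nonneg _)]
    · have hI : Finset.Iio (0 : Fin (m + 1)) = ∅ := by ext; simp
      simp only [sum_Iio_succ, Nat.sub_add_eq, hI, Finset.sum_empty, Nat.sub_zero]
    · intro x hx
      obtain ⟨L, hL, hx⟩ := List.mem_flatten.1 hx
      obtain ⟨i, rfl⟩ := (List.mem_ofFn' _ _).1 hL
      have h2 := h0 i
      have h3 := List.mem_range'_1.1 hx
      omega

end CuntzRep

/-! ### Block decompositions and ordered products. -/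

theorem IsBlockDecomposition.lt {S : Finset ℕ} {m : ℕ} {n l : Fin m → ℕ}
    (h : IsBlockDecomposition S n l) (i j : Fin m) (hij : i < j) : n i + l i + 1 < n j := by
  obtain ⟨i, hi⟩ := i
  obtain ⟨j, hj⟩ := j
  simp only [Fin.mk_lt_mk] at hij
  induction j, hij using Nat.le_induction with
  | base => exact h.2 ⟨i, hi⟩ ⟨i + 1, hj⟩ rfl
  | succ j hij ih =>
    have h1 := ih (Nat.lt_of_succ_lt hj)
    have h2 := h.2 ⟨j, Nat.lt_of_succ_lt hj⟩ ⟨j + 1, hj⟩ rfl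
    omega

theorem IsBlockDecomposition.sort_eq {S : Finset ℕ} {m : ℕ} {n l : Fin m → ℕ}
    (h : IsBlockDecomposition S n l) :
    S.sort (· ≤ ·) = (List.ofFn fun i => List.range' (n i) (l i + 1)).flatten := by
  have hlt : (List.ofFn fun i => List.range' (n i) (l i + 1)).flatten.Pairwise (· < ·) := by
    rw [List.pairwise_flatten]
    constructor
    · intro L hL
      obtain ⟨i, rfl⟩ := (List.mem_ofFn' _ _).1 hL
      exact List.pairwise_lt_range'
    · rw [List.pairwise_ofFn]
      intro i j hij x hx y hy
      have h1 := h.lt i j hij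
      have h2 := List.mem_range'_1.1 hx
      have h3 := List.mem_range'_1.1 hy
      omega
  have hS : S = (List.ofFn fun i => List.range' (n i) (l i + 1)).flatten.toFinset := by
    rw [h.1]
    ext x
    simp only [Finset.mem_biUnion, Finset.mem_univ, true_and, Finset.mem_Icc, List.mem_toFinset,
      List.mem_flatten, List.mem_ofFn', Set.mem_range, exists_exists_eq_and, List.mem_range'_1]
    exact exists_congr fun i => by omega
  rw [hS]
  exact (List.toFinset_sort (· ≤ ·) (hlt.imp fun h => h.ne)).2 (hlt.imp fun h => h.le)

theorem FermiFock.creation_vac {H : Type*} [NormedAddCommGroup H] [InnerProductSpace ℂ H]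
    [CompleteSpace H] (F : FermiFock H) (S : Finset ℕ) : F.creation S F.vac =
      fockVec (fun n => (adjoint (F.a n) : H →ₗ[ℂ] H)) F.vac (S.sort (· ≤ ·)) := by
  rw [FermiFock.creation]
  generalize S.sort (· ≤ ·) = L
  induction L with
  | nil => simp [fockVec_nil]
  | cons n L ih =>
    rw [fockVec_cons, ← ih]
    simp

/-! ### The unitaries `V_B`, `V_F` and the transfer to the given Fock spaces. -/

section Equivalences

variable {H HB HF : Type*}
    [NormedAddCommGroup H] [InnerProductSpace ℂ H] [CompleteSpace H]
    [NormedAddCommGroup HB] [InnerProductSpace ℂ HB] [CompleteSpace HB]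
    [NormedAddCommGroup HF] [InnerProductSpace ℂ HF] [CompleteSpace HF]
    {C : CuntzRep H} {B : BoseFock HB} {F : FermiFock HF}

theorem denseRange_subtype_comp {E M : Type*} [NormedAddCommGroup E] [InnerProductSpace ℂ E]
    [AddCommGroup M] [Module ℂ M] {D : Submodule ℂ E} (hD : Dense (D : Set E)) {f : M →ₗ[ℂ] D}
    (hf : LinearMap.range f = ⊤) : DenseRange (D.subtype ∘ₗ f) := by
  have : (LinearMap.range (D.subtype ∘ₗ f) : Set E) = D := by
    rw [LinearMap.range_comp, hf, Submodule.map_subtype_top]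
  rw [LinearMap.coe_range] at this
  rwa [DenseRange, this]

theorem IsBoseEquiv.map_pow_bdag {V : H ≃ₗᵢ[ℂ] HB} (hV : IsBoseEquiv C B V) (n k : ℕ) (x : C.D)
    (y : B.D) (h : V x = y) : V ((C.rbsDag n ^ k) x) = ((B.bdag n ^ k) y) := by
  induction k with
  | zero => exact h
  | succ k ih =>
    rw [pow_succ', pow_succ']
    exact hV.map_bdag n _ _ ih

theorem IsBoseEquiv.map_fockVec {V : H ≃ₗᵢ[ℂ] HB} (hV : IsBoseEquiv C B V) (L : List ℕ) :
    V (fockVec C.rbsDag C.ΩD L : C.D) = fockVec B.bdag B.vac L := by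
  induction L with
  | nil => rw [fockVec_nil, fockVec_nil]; exact hV.map_Ω
  | cons n L ih => rw [fockVec_cons, fockVec_cons]; exact hV.map_bdag n _ _ ih

theorem IsBoseEquiv.map_fockMap {V : H ≃ₗᵢ[ℂ] HB} (hV : IsBoseEquiv C B V) (f : List ℕ →₀ ℂ) :
    V (fockMap C.rbsDag C.ΩD f) = fockMap B.bdag B.vac f := by
  have h : (V : H →ₗ[ℂ] HB) ∘ₗ C.D.subtype ∘ₗ fockMap C.rbsDag C.ΩD =
      B.D.subtype ∘ₗ fockMap B.bdag B.vac := by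
    ext L
    simpa [fockMap_single] using hV.map_fockVec L
  exact LinearMap.congr_fun h f

/-- Both maps `fockMap` are surjective onto the domains, so matching formal combinations carries `D`
exactly onto `B.D`. Creations and annihilations are intertwined because both come from the same
formal operators. -/
theorem existsUnique_isBoseEquiv (C : CuntzRep H) (B : BoseFock HB) :
    ∃! V : H ≃ₗᵢ[ℂ] HB, IsBoseEquiv C B V := by
  have hC := denseRange_subtype_comp C.dense_D C.range_fockMap_rbsDag
  have hB := denseRange_subtype_comp B.dense_D B.range_fockMap
  obtain ⟨V, hV⟩ := exists_linearIsometryEquiv_of_norm_eq _ _ hC hB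
    (fun f => C.isFockModule_rbs.norm_fockMap_eq B.isFockModule f)
  have hV' : ∀ f, V (fockMap C.rbsDag C.ΩD f) = fockMap B.bdag B.vac f := hV
  have hsurj : ∀ x : C.D, ∃ f, fockMap C.rbsDag C.ΩD f = x :=
    LinearMap.range_eq_top.1 C.range_fockMap_rbsDag
  have hsurj' : ∀ x : B.D, ∃ f, fockMap B.bdag B.vac f = x :=
    LinearMap.range_eq_top.1 B.range_fockMap
  refine ⟨V, ⟨fun x => ⟨fun hx => ?_, fun hx => ?_⟩, ?_, ?_, ?_⟩, fun W hW => ?_⟩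
  · obtain ⟨f, hf⟩ := hsurj' ⟨_, hx⟩
    have h := hV' f
    rw [hf] at h
    rw [← V.injective h]
    exact (fockMap C.rbsDag C.ΩD f).2
  · obtain ⟨f, hf⟩ := hsurj ⟨_, hx⟩
    have h := hV' f
    rw [hf] at h
    rw [h]
    exact (fockMap B.bdag B.vac f).2
  · have h := hV' (Finsupp.single [] 1)
    rwa [fockMap_single, fockMap_single, fockVec_nil, fockVec_nil] at h
  · intro n x y hxy
    obtain ⟨f, rfl⟩ := hsurj x
    rw [hV' f] at hxy
    rw [← Subtype.ext hxy, ← C.isFockModule_rbs.fockMap_formalAnnihilation, hV',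
      B.isFockModule.fockMap_formalAnnihilation]
  · intro n x y hxy
    obtain ⟨f, rfl⟩ := hsurj x
    rw [hV' f] at hxy
    rw [← Subtype.ext hxy, ← fockMap_formalCreation, hV', fockMap_formalCreation]
  · exact linearIsometryEquiv_ext_of_dense hC fun f => (hW.map_fockMap f).trans (hV' f).symm

theorem IsFermiEquiv.map_adjoint {V : H ≃ₗᵢ[ℂ] HF} (hV : IsFermiEquiv C F V) (n : ℕ) (x : H) :
    V (C.rfsDag n x) = adjoint (F.a n) (V x) := by
  refine ext_inner_left ℂ fun y => ?_
  obtain ⟨y, rfl⟩ := V.surjective y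
  rw [V.inner_map_map, ContinuousLinearMap.adjoint_inner_right, ← hV.map_a, V.inner_map_map]
  exact ContinuousLinearMap.adjoint_inner_right _ _ _

theorem IsFermiEquiv.map_fockVec {V : H ≃ₗᵢ[ℂ] HF} (hV : IsFermiEquiv C F V) (L : List ℕ) :
    V (fockVec C.rfsDag C.Ω L) =
      fockVec (fun n => (adjoint (F.a n) : HF →ₗ[ℂ] HF)) F.vac L := by
  induction L with
  | nil => rw [fockVec_nil, fockVec_nil]; exact hV.map_Ω
  | cons n L ih => rw [fockVec_cons, fockVec_cons, hV.map_adjoint, ih]; rfl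

theorem IsFermiEquiv.map_fockMap {V : H ≃ₗᵢ[ℂ] HF} (hV : IsFermiEquiv C F V) (f : List ℕ →₀ ℂ) :
    V (fockMap C.rfsDag C.Ω f) =
      fockMap (fun n => (adjoint (F.a n) : HF →ₗ[ℂ] HF)) F.vac f := by
  have h : (V : H →ₗ[ℂ] HF) ∘ₗ fockMap C.rfsDag C.Ω =
      fockMap (fun n => (adjoint (F.a n) : HF →ₗ[ℂ] HF)) F.vac := by
    ext L
    simpa [fockMap_single] using hV.map_fockVec L
  exact LinearMap.congr_fun h f

theorem existsUnique_isFermiEquiv (C : CuntzRep H) (F : FermiFock HF) :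
    ∃! V : H ≃ₗᵢ[ℂ] HF, IsFermiEquiv C F V := by
  have hC := C.dense_range_fockMap_rfsDag
  obtain ⟨V, hV⟩ := exists_linearIsometryEquiv_of_norm_eq _ _ hC F.denseRange_fockMap
    (fun f => C.isFockModule_rfs.norm_fockMap_eq F.isFockModule f)
  refine ⟨V, ⟨?_, fun n x => ?_⟩, fun W hW => ?_⟩
  · have h := hV (Finsupp.single [] 1)
    rwa [fockMap_single, fockMap_single, fockVec_nil, fockVec_nil] at h
  -- Here the creation vectors only span a dense subspace; boundedness of the operators extends the
  -- intertwining to all of `H`.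
  · refine congrFun (hC.equalizer (V.continuous.comp (C.rfs n).continuous)
      ((F.a n).continuous.comp V.continuous) (funext fun f => ?_)) x
    change V (C.rfs n (fockMap C.rfsDag C.Ω f)) = F.a n (V (fockMap C.rfsDag C.Ω f))
    have h₁ := C.isFockModule_rfs.fockMap_formalAnnihilation n f
    have h₂ := F.isFockModule.fockMap_formalAnnihilation n f
    rw [hV]
    exact (congrArg V h₁.symm).trans ((hV _).trans h₂)
  · exact linearIsometryEquiv_ext_of_dense hC fun f => (hW.map_fockMap f).trans (hV f).symm

theorem IsBoseEquiv.map_prod_pow_bdag {V : H ≃ₗᵢ[ℂ] HB} (hV : IsBoseEquiv C B V) {m : ℕ}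
    (n k : Fin m → ℕ) : V ((List.ofFn fun i => C.rbsDag (n i) ^ k i).prod C.ΩD) =
      ((List.ofFn fun i => B.bdag (n i) ^ k i).prod B.vac : B.D) := by
  induction m with
  | zero => simpa [CuntzRep.ΩD] using hV.map_Ω
  | succ m ih =>
    rw [List.ofFn_succ, List.ofFn_succ, List.prod_cons, List.prod_cons, Module.End.mul_apply,
      Module.End.mul_apply]
    exact hV.map_pow_bdag _ _ _ _ (ih _ _)

theorem adjoint_boseFermiU_apply (VB : H ≃ₗᵢ[ℂ] HB) (VF : H ≃ₗᵢ[ℂ] HF) (x : H) :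
    adjoint (boseFermiU VB VF) (VF x) = VB x := by
  refine ext_inner_left ℂ fun y => ?_
  obtain ⟨y, rfl⟩ := VB.surjective y
  rw [ContinuousLinearMap.adjoint_inner_right, VB.inner_map_map, boseFermiU]
  have h : adjoint (VB : H →L[ℂ] HB) (VB y) = y := by
    refine ext_inner_left ℂ fun z => ?_
    rw [ContinuousLinearMap.adjoint_inner_right]
    exact VB.inner_map_map z y
  change ⟪VF (adjoint (VB : H →L[ℂ] HB) (VB y)), VF x⟫_ℂ = _
  rw [h, VF.inner_map_map]

end Equivalences

theorem mainTheorem3 {H HB HF : Type*}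
    [NormedAddCommGroup H] [InnerProductSpace ℂ H] [CompleteSpace H]
    [NormedAddCommGroup HB] [InnerProductSpace ℂ HB] [CompleteSpace HB]
    [NormedAddCommGroup HF] [InnerProductSpace ℂ HF] [CompleteSpace HF]
    (C : CuntzRep H) (B : BoseFock HB) (F : FermiFock HF) :
    (∃! VB : H ≃ₗᵢ[ℂ] HB, IsBoseEquiv C B VB) ∧
    (∃! VF : H ≃ₗᵢ[ℂ] HF, IsFermiEquiv C F VF) ∧
    ∀ (VB : H ≃ₗᵢ[ℂ] HB) (VF : H ≃ₗᵢ[ℂ] HF), IsBoseEquiv C B VB → IsFermiEquiv C F VF →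
      adjoint (boseFermiU VB VF) F.vac = B.vac ∧
      ∀ (S : Finset ℕ) (_ : S.Nonempty) (m : ℕ) (n l : Fin m → ℕ),
        IsBlockDecomposition S n l →
        adjoint (boseFermiU VB VF) (F.creation S F.vac) =
          (((Real.sqrt (∏ i, (l i + 1)! : ℕ))⁻¹ : ℝ) : ℂ) •
            (((List.ofFn fun i : Fin m =>
              B.bdag (n i - ∑ j ∈ Finset.Iio i, (l j + 1)) ^ (l i + 1)).prod B.vac : B.D) : HB) := by
  refine ⟨existsUnique_isBoseEquiv C B, existsUnique_isFermiEquiv C F, ?_⟩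
  intro VB VF hB hF
  constructor
  · rw [← hF.map_Ω, adjoint_boseFermiU_apply, hB.map_Ω]
  · intro S _ m n l h
    -- Pulled back to `H` by `V_F`, the fermionic vector is rewritten there as a bosonic one and
    -- then pushed forward by `V_B`.
    rw [F.creation_vac, ← hF.map_fockVec, adjoint_boseFermiU_apply, h.sort_eq,
      C.fockVec_flatten_blocks n l h.lt, map_smul, hB.map_prod_pow_bdag]
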